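/- Let $\mathbb R^\infty=\bigcup_n\mathbb R^n$ be the space of finitely supported real sequences, with the standard inner product $\langle\cdot,\cdot\rangle$, and let $G(k,\mathbb R^\infty)=\bigcup_n G(k,\mathbb R^n)$ be the set of its $k$-dimensional linear subspaces, with the colimit topology (a set is open if and only if its intersection with every $G(k,\mathbb R^n)$ is open). Let $A_1\subseteq A_2\subseteq A_3\subseteq\cdots\subset\mathbb R^\infty$ be finite sets whose union spans $\mathbb R^\infty$, such that for every $i$ each element of $A_{i+1}\setminus A_i$ has all of its first $i$ coordinates equal to zero. For $V\in G(k,\mathbb R^\infty)$, the oriented matroid of $V$ on $A_i$ is the set of covectors $\{\,(a\mapsto\operatorname{sign}\langle v,a\rangle)_{a\in A_i} : v\in V\,\}\subseteq\{+,-,0\}^{A_i}$, and the matroid of $V$ on $A_i$ is the subset of $\{1,0\}^{A_i}$ obtained from it by identifying $+$ and $-$ with $1$. The generalized oriented matroid stratification (respectively, generalized matroid stratification) of $G(k,\mathbb R^\infty)$ given by $(A_i)$ is the partition in which $V$ and $W$ lie in the same stratum if and only if they have the same oriented matroid (respectively, the same matroid) on $A_i$ for every $i$. A weak subdivision of a partition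 $P$ of a topological space $X$ is a partition $Q$ of $X$ such that: every element of $P$ is a union of elements of $Q$; every element of $Q$ is connected; every compact subset of $X$ meets only finitely many elements of $Q$; and whenever $U,V\in Q$ satisfy $U\cap\overline V\ne\emptyset$, then $U\subseteq\overline V$. **Theorem.** Let $k\ge 3$, and let $(A_i)$ be any sequence as above. Then neither the generalized oriented matroid stratification nor the generalized matroid stratification of $G(k,\mathbb R^\infty)$ given by $(A_i)$ has a weak subdivision. -/

import Mathlib

/-- `ℝ^∞`, the union of the spaces `ℝ^n`: finitely supported real sequences. -/
abbrev RInf : Type := ℕ →₀ ℝ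

/-- The standard inclusion `ℝ^n → ℝ^∞` as the first `n` coordinates. -/
noncomputable def inclRn (n : ℕ) : (Fin n → ℝ) →ₗ[ℝ] RInf :=
  (Finsupp.lmapDomain ℝ ℝ (Fin.val : Fin n → ℕ)) ∘ₗ
    (Finsupp.linearEquivFunOnFinite ℝ ℝ (Fin n)).symm.toLinearMap

theorem inclRn_injective (n : ℕ) : Function.Injective (inclRn n) := by
  have h := Finsupp.mapDomain_injective (M := ℝ) (Fin.val_injective (n := n))
  exact h.comp (Finsupp.linearEquivFunOnFinite ℝ ℝ (Fin n)).symm.injective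

/-- The (real) Grassmannian `G(k, E)`: the set of `k`-dimensional linear subspaces of `E`. -/
def Grassmannian (k : ℕ) (E : Type) [AddCommGroup E] [Module ℝ E] : Type :=
  {V : Submodule ℝ E // Module.Finite ℝ V ∧ Module.finrank ℝ V = k}

/-- The `k`-plane spanned by a linearly independent `k`-tuple of vectors. -/
def Grassmannian.spanFrame {k : ℕ} {E : Type} [AddCommGroup E] [Module ℝ E]
    (f : {f : Fin k → E // LinearIndependent ℝ f}) : Grassmannian k E :=
  ⟨Submodule.span ℝ (Set.range f.1),
    Module.Finite.span_of_finite ℝ (Set.finite_range f.1),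
    by rw [finrank_span_eq_card f.2, Fintype.card_fin]⟩

/-- The inclusion `G(k, ℝ^n) → G(k, ℝ^∞)`. -/
noncomputable def Grassmannian.incl (k n : ℕ) (V : Grassmannian k (Fin n → ℝ)) :
    Grassmannian k RInf :=
  ⟨V.1.map (inclRn n), by
    have := V.2.1
    exact ⟨inferInstance,
      ((V.1.equivMapOfInjective _ (inclRn_injective n)).finrank_eq).symm.trans V.2.2⟩⟩

/-- The usual topology of `G(k, ℝ^n)`: the quotient topology from the space of linearly
independent `k`-tuples of vectors of `ℝ^n`. -/
instance Grassmannian.instTopologicalSpaceFin (k n : ℕ) :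
    TopologicalSpace (Grassmannian k (Fin n → ℝ)) :=
  TopologicalSpace.coinduced Grassmannian.spanFrame inferInstance

/-- The topology of `G(k, ℝ^∞)` as the union (colimit) of the `G(k, ℝ^n)`: a set is open if and
only if its preimage in every `G(k, ℝ^n)` is open. -/
noncomputable instance Grassmannian.instTopologicalSpaceInf (k : ℕ) :
    TopologicalSpace (Grassmannian k RInf) :=
  ⨆ n : ℕ, TopologicalSpace.coinduced (Grassmannian.incl k n) inferInstance

/-- The standard inner product on `ℝ^∞`. -/
noncomputable def dotInf (v w : RInf) : ℝ := v.sum fun j x => x * w j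

/-- The oriented matroid on the ground set `A` determined by a subspace `V`, given by its set of
covectors `a ↦ sign ⟨v, a⟩`, `v ∈ V`. -/
noncomputable def orientedMatroidOf (A : Set RInf) (V : Submodule ℝ RInf) :
    Set (A → SignType) :=
  {f | ∃ v ∈ V, f = fun a : A => SignType.sign (dotInf v a)}

/-- The matroid on the ground set `A` determined by a subspace `V`, given by its set of
covectors; a covector `A → {1, 0}`, `a ↦ 1` if and only if `⟨v, a⟩ ≠ 0`, is recorded as a
predicate on `A`. -/
def matroidOf (A : Set RInf) (V : Submodule ℝ RInf) : Set (A → Prop) :=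
  {f | ∃ v ∈ V, f = fun a : A => dotInf v a ≠ 0}

/-- A compatible sequence `A 0 ⊆ A 1 ⊆ A 2 ⊆ ⋯` of finite subsets of `ℝ^∞`, whose union spans
`ℝ^∞`, and such that the first `i` coordinates of every element of `A (i + 1) \ A i` are zero.
(There is no condition on the elements of `A 1`, so starting the sequence at `A 0` instead of
`A 1` makes no difference.) -/
structure IsCompatibleSequence (A : ℕ → Set RInf) : Prop where
  mono : ∀ i, A i ⊆ A (i + 1)
  finite : ∀ i, (A i).Finite
  span_eq_top : Submodule.span ℝ (⋃ i, A i) = ⊤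
  coord_eq_zero : ∀ i, ∀ a ∈ A (i + 1) \ A i, ∀ j < i, a j = 0

/-- The generalized oriented matroid stratification of `G(k, ℝ^∞)` given by the sequence `A`: two
`k`-planes are in the same stratum if and only if they determine the same oriented matroid on
every `A i`. -/
def orientedMatroidStratification (k : ℕ) (A : ℕ → Set RInf) : Set (Set (Grassmannian k RInf)) :=
  {U | ∃ V : Grassmannian k RInf,
    U = {W | ∀ i, orientedMatroidOf (A i) W.1 = orientedMatroidOf (A i) V.1}}

/-- The generalized matroid stratification of `G(k, ℝ^∞)` given by the sequence `A`. -/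
def matroidStratification (k : ℕ) (A : ℕ → Set RInf) : Set (Set (Grassmannian k RInf)) :=
  {U | ∃ V : Grassmannian k RInf, U = {W | ∀ i, matroidOf (A i) W.1 = matroidOf (A i) V.1}}

/-- `Q` is a weak subdivision of the partition `P` of the space `X`. -/
structure IsWeakSubdivision {X : Type} [TopologicalSpace X] (Q P : Set (Set X)) : Prop where
  isPartition : Setoid.IsPartition Q
  refines : ∀ U ∈ P, ∃ S ⊆ Q, U = ⋃₀ S
  connected : ∀ U ∈ Q, IsConnected U
  locallyFinite : ∀ K : Set X, IsCompact K → {U ∈ Q | (U ∩ K).Nonempty}.Finite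
  normal : ∀ U ∈ Q, ∀ V ∈ Q, (U ∩ closure V).Nonempty → U ⊆ closure V

/-!
A sequence `x j` of planes is constructed that converges in `G(k, ℝ^∞)` and whose terms are
separated from each other by the closures of strata: `x j` lies in the closure of a stratum `U j`,
and no other `x l` does. This excludes weak subdivisions (`not_isWeakSubdivision_of_separating`).
Indeed, the sequence and its limit form a compact set, so two terms `x j`, `x l` lie in one
member `Z` of `Q`. Local finiteness along a sequence in `U j` that tends to `x j` gives a member of
`Q` inside `U j` whose closure contains `x j`; by normality this closure contains `Z`, hence `x l`.

The strata `U j` come from the von Staudt construction. Four elements of the ground set induce on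
`x j` four points of a projective line with cross ratio `j + 1`, a closed condition on planes
(`isClosed_crossRatioDefect`). Adding further elements of the ground set as auxiliary points of
the construction forces the cross ratio to be `j + 1` on a whole matroid stratum
(`IsVonStaudtConfig.crossRatioDefect_eq_zero`); this needs a projective plane, whence `3 ≤ k`. The
auxiliary points are chosen independent modulo a finite part `A M` of the ground set that contains
all elements not orthogonal to the planes `x j`. They can therefore be scaled by `t > 0` together with
all other elements outside `A M`, which does not change the oriented matroid
(`orientedMatroidOf_span_add_smul`), and as `t → 0` the plane tends to `x j`, on which all
these elements vanish. Oriented matroid strata are contained in matroid strata, so the same planes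
serve for both stratifications.
-/

open Filter Topology

/-! ### Partitions that are locally finite and satisfy the frontier condition -/

/-- A member of `Q` meeting the limit of a sequence in `U ∈ P` lies in `closure U`: the sequence
together with its limit is compact, so finitely many members of `Q` cover the sequence, and the
limit is in the closure of one of them, which is contained in `U`. -/
theorem IsWeakSubdivision.subset_closure_of_tendsto {X : Type} [TopologicalSpace X]
    {Q P : Set (Set X)} (hQ : IsWeakSubdivision Q P) {U : Set X} (hU : U ∈ P) {y : ℕ → X} {x : X}
    (hy : ∀ m, y m ∈ U) (hyx : Tendsto y atTop (𝓝 x)) {Z : Set X} (hZ : Z ∈ Q) (hx : x ∈ Z) :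
    Z ⊆ closure U := by
  obtain ⟨S, hSQ, hUS⟩ := hQ.refines U hU
  have hK := hQ.locallyFinite _ hyx.isCompact_insert_range
  set T := {Y ∈ S | (Y ∩ insert x (Set.range y)).Nonempty}
  have hT : T.Finite := hK.subset fun Y hY => ⟨hSQ hY.1, hY.2⟩
  have hcov : Set.range y ⊆ ⋃ Y ∈ T, Y := by
    rintro _ ⟨m, rfl⟩
    have := hy m
    rw [hUS] at this
    obtain ⟨Y, hY, hmY⟩ := this
    exact Set.mem_biUnion (x := Y) ⟨hY, y m, hmY, Or.inr ⟨m, rfl⟩⟩ hmY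
  have hxc : x ∈ closure (⋃ Y ∈ T, Y) :=
    mem_closure_of_tendsto hyx (Eventually.of_forall fun m => hcov ⟨m, rfl⟩)
  rw [hT.closure_biUnion] at hxc
  obtain ⟨Y, hY, hxY⟩ := Set.mem_iUnion₂.1 hxc
  refine (hQ.normal Z hZ Y (hSQ hY.1) ⟨x, hx, hxY⟩).trans (closure_mono ?_)
  rw [hUS]
  exact Set.subset_sUnion_of_mem hY.1

/-- Two terms of a convergent sequence `x` lie in the same member of `Q`, which is
incompatible with the closed sets `C j` separating the terms. -/
theorem not_isWeakSubdivision_of_separating {X : Type} [TopologicalSpace X] {P : Set (Set X)}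
    {x : ℕ → X} {z : X} (hx : Tendsto x atTop (𝓝 z)) {U C : ℕ → Set X} (hU : ∀ j, U j ∈ P)
    (hUC : ∀ j, U j ⊆ C j) (hC : ∀ j, IsClosed (C j))
    {y : ℕ → ℕ → X} (hy : ∀ j m, y j m ∈ U j) (hyx : ∀ j, Tendsto (y j) atTop (𝓝 (x j)))
    (hsep : ∀ j l, x l ∈ C j → l = j) : ¬ ∃ Q, IsWeakSubdivision Q P := by
  rintro ⟨Q, hQ⟩
  have hK := hQ.locallyFinite _ hx.isCompact_insert_range
  have hcell : ∀ j, ∃ Z ∈ Q, x j ∈ Z := fun j => (hQ.isPartition.2 (x j)).exists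
  choose Z hZQ hxZ using hcell
  have := hK.to_subtype
  obtain ⟨j, l, hjl, h⟩ := Finite.exists_ne_map_eq_of_infinite
    (fun j => (⟨Z j, hZQ j, x j, hxZ j, Or.inr ⟨j, rfl⟩⟩ :
      {U ∈ Q | (U ∩ insert z (Set.range x)).Nonempty}))
  have hZ : Z j = Z l := congrArg Subtype.val h
  refine hjl (hsep j l ?_).symm
  have h1 := hQ.subset_closure_of_tendsto (hU j) (hy j) (hyx j) (hZQ j) (hxZ j)
  exact closure_minimal (hUC j) (hC j) (h1 (hZ ▸ hxZ l))

/-! ### The inner product on `ℝ^∞` -/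

/-- The standard inner product as a bilinear form. -/
noncomputable def dotForm : RInf →ₗ[ℝ] RInf →ₗ[ℝ] ℝ :=
  LinearMap.mk₂ ℝ dotInf
    (fun v v' w => Finsupp.sum_add_index' (by simp) (by intros; ring))
    (fun c v w => by
      rw [dotInf, Finsupp.sum_smul_index (by simp), dotInf, Finsupp.smul_sum]
      simp [mul_assoc])
    (fun v w w' => by simp [dotInf, mul_add, Finsupp.sum_add])
    (fun c v w => by simp [dotInf, Finsupp.mul_sum, mul_left_comm])

theorem dotForm_apply (v w : RInf) : dotForm v w = dotInf v w := rfl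

theorem dotForm_single (i : ℕ) (w : RInf) : dotForm (Finsupp.single i 1) w = w i := by
  simp [dotForm_apply, dotInf]

theorem dotForm_eq_zero_of_disjoint {M : ℕ} {v w : RInf} (hv : ∀ j, M ≤ j → v j = 0)
    (hw : ∀ j < M, w j = 0) : dotForm v w = 0 := by
  refine Finset.sum_eq_zero fun j _ => ?_
  rcases le_or_gt M j with h | h
  · simp [hv j h]
  · simp [hw j h]

/-- Prescribing the inner products with finitely many linearly independent vectors. -/
theorem exists_dotForm_eq {B : Set RInf} (hB : LinearIndependent ℝ ((↑) : B → RInf))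
    {T : Set RInf} (hT : T.Finite) (hTB : T ⊆ B) (y : RInf → ℝ) :
    ∃ h : RInf, ∀ b ∈ T, dotForm h b = y b := by
  have hTi : LinearIndependent ℝ ((↑) : T → RInf) :=
    hB.comp (Set.inclusion hTB) (Set.inclusion_injective hTB)
  have := hT.fintype
  let Φ : RInf →ₗ[ℝ] (T → ℝ) := LinearMap.pi fun t => dotForm.flip t
  have hΦ : LinearMap.range Φ = ⊤ := by
    by_contra hne
    obtain ⟨φ, hφ0, hφ⟩ := Submodule.exists_le_ker_of_lt_top _ (lt_top_iff_ne_top.2 hne)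
    apply hφ0
    have hsum : ∑ t : T, φ (Pi.single t 1) • (t : RInf) = 0 := by
      ext i
      have h1 : φ (Φ (Finsupp.single i 1)) = 0 := hφ ⟨_, rfl⟩
      rw [← dotForm_single, map_sum, Finsupp.zero_apply, ← h1, LinearMap.pi_apply_eq_sum_univ φ]
      refine Finset.sum_congr rfl fun t _ => ?_
      rw [show (fun j => if t = j then (1 : ℝ) else 0) = Pi.single t 1 by
        ext j; simp [Pi.single_apply, eq_comm]]
      simp [Φ, mul_comm]
    have h0 := Fintype.linearIndependent_iff.1 hTi _ hsum
    refine LinearMap.pi_ext' fun t => LinearMap.ext_ring ?_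
    simpa using h0 t
  obtain ⟨h, hh⟩ := LinearMap.range_eq_top.1 hΦ fun t => y t
  exact ⟨h, fun b hb => congrFun hh ⟨b, hb⟩⟩

/-- A spanning set of `ℝ^∞` contains a sequence that is linearly independent modulo a given finite
set `F`, expressed through the existence of dual vectors orthogonal to `F`. -/
theorem exists_seq_dotForm_eq {S : Set RInf} (hS : Submodule.span ℝ S = ⊤) {F : Set RInf}
    (hF : F.Finite) : ∃ c : ℕ → RInf, (∀ r, c r ∈ S) ∧ ∀ (N : ℕ) (y : ℕ → ℝ), ∃ h : RInf,
      (∀ a ∈ F, dotForm h a = 0) ∧ ∀ r < N, dotForm h (c r) = y r := by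
  classical
  obtain ⟨B, hBS, hBspan, hB⟩ := exists_linearIndependent ℝ S
  rw [hS] at hBspan
  have hinf : B.Infinite := by
    intro hfin
    have hfd : Module.Finite ℝ RInf :=
      Module.finite_def.2 (hBspan ▸ Submodule.fg_span hfin)
    have := (Finsupp.basisSingleOne (R := ℝ) (ι := ℕ)).linearIndependent.finite
    exact not_finite ℕ
  have hrep : ∀ a : RInf, ∃ T : Finset RInf, (T : Set RInf) ⊆ B ∧
      a ∈ Submodule.span ℝ (T : Set RInf) := fun a => by
    obtain ⟨T, hT, ha⟩ := Submodule.mem_span_finite_of_mem_span (S := B) (R := ℝ)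
      (x := a) (hBspan ▸ trivial)
    exact ⟨T, hT, ha⟩
  choose T hTB haT using hrep
  let B₀ : Set RInf := ⋃ a ∈ F, (T a : Set RInf)
  have hB₀ : B₀.Finite := hF.biUnion fun a _ => (T a).finite_toSet
  have hB₀B : B₀ ⊆ B := Set.iUnion₂_subset fun a _ => hTB a
  let c := (hinf.sdiff hB₀).natEmbedding
  have hc : ∀ r, (c r : RInf) ∈ B \ B₀ := fun r => (c r).2
  refine ⟨fun r => c r, fun r => hBS (hc r).1, fun N y => ?_⟩
  let y' : RInf → ℝ := fun b => if h : b ∈ B \ B₀ then y (Function.invFun c ⟨b, h⟩) else 0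
  obtain ⟨h, hh⟩ := exists_dotForm_eq hB
    (T := B₀ ∪ (fun r => (c r : RInf)) '' Set.Iio N)
    (hB₀.union ((Set.finite_Iio N).image _))
    (Set.union_subset hB₀B (by rintro _ ⟨r, _, rfl⟩; exact (hc r).1)) y'
  refine ⟨h, fun a ha => ?_, fun r hr => ?_⟩
  · have hle : Submodule.span ℝ (T a : Set RInf) ≤ LinearMap.ker (dotForm h) := by
      rw [Submodule.span_le]
      intro b hb
      have hb0 : b ∈ B₀ := Set.mem_biUnion ha hb
      have := hh b (Or.inl hb0)
      simpa [y', hb0] using this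
    exact hle (haT a)
  · rw [hh _ (Or.inr ⟨r, hr, rfl⟩)]
    simp only [y', dif_pos (hc r)]
    rw [Function.leftInverse_invFun c.injective r]

/-! ### Curves and closed sets in the infinite Grassmannian -/

theorem inclRn_apply_of_lt {n : ℕ} (x : Fin n → ℝ) (i : Fin n) : inclRn n x i = x i := by
  have := Finsupp.mapDomain_apply (Fin.val_injective (n := n))
    ((Finsupp.linearEquivFunOnFinite ℝ ℝ (Fin n)).symm x) i
  simpa [inclRn] using this

theorem inclRn_apply_of_le {n : ℕ} (x : Fin n → ℝ) {j : ℕ} (hj : n ≤ j) : inclRn n x j = 0 := by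
  simp only [inclRn, LinearMap.comp_apply, Finsupp.lmapDomain_apply]
  refine Finsupp.mapDomain_of_notMem_range _ _ ?_
  rintro ⟨i, rfl⟩
  exact absurd i.2 (by omega)

theorem exists_inclRn_eq {n : ℕ} {v : RInf} (hv : ∀ j, n ≤ j → v j = 0) :
    inclRn n (fun i => v i) = v := by
  ext j
  rcases lt_or_ge j n with h | h
  · exact inclRn_apply_of_lt _ ⟨j, h⟩
  · rw [inclRn_apply_of_le _ h, hv j h]

theorem exists_forall_le_apply_eq_zero {ι : Type} [Finite ι] (f : ι → RInf) :
    ∃ n, ∀ i j, n ≤ j → f i j = 0 := by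
  classical
  have := Fintype.ofFinite ι
  refine ⟨(Finset.univ.biUnion fun i => (f i).support).sup id + 1, fun i j hj => ?_⟩
  by_contra h
  have hmem : j ∈ Finset.univ.biUnion fun i => (f i).support := by
    simpa using ⟨i, h⟩
  have := Finset.le_sup (f := id) hmem
  simp only [id] at this
  omega

/-- The plane spanned by a frame moving along a line depends continuously on the parameter. -/
theorem continuous_spanFrame_add_smul {k : ℕ} (f h : Fin k → RInf)
    (hi : ∀ t : ℝ, LinearIndependent ℝ fun i => f i + t • h i) :
    Continuous fun t : ℝ => Grassmannian.spanFrame (⟨fun i => f i + t • h i, hi t⟩ :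
      {f : Fin k → RInf // LinearIndependent ℝ f}) := by
  obtain ⟨n, hn⟩ := exists_forall_le_apply_eq_zero (Sum.elim f h)
  let f' : Fin k → Fin n → ℝ := fun i j => f i j
  let h' : Fin k → Fin n → ℝ := fun i j => h i j
  have hf : ∀ i, inclRn n (f' i) = f i := fun i => exists_inclRn_eq (hn (.inl i))
  have hh : ∀ i, inclRn n (h' i) = h i := fun i => exists_inclRn_eq (hn (.inr i))
  have hcomp : ∀ t : ℝ, (inclRn n ∘ fun i => f' i + t • h' i) = fun i => f i + t • h i := by
    intro t
    funext i
    simp [hf, hh]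
  have hi' : ∀ t : ℝ, LinearIndependent ℝ fun i => f' i + t • h' i := fun t =>
    LinearIndependent.of_comp (inclRn n) (by rw [hcomp]; exact hi t)
  have h1 : Continuous fun t : ℝ => (⟨fun i => f' i + t • h' i, hi' t⟩ :
      {f : Fin k → Fin n → ℝ // LinearIndependent ℝ f}) :=
    Continuous.subtype_mk (by fun_prop) _
  have h2 : Continuous (Grassmannian.spanFrame (k := k) (E := Fin n → ℝ)) :=
    continuous_coinduced_rng
  have h3 : Continuous (Grassmannian.incl k n) :=
    continuous_iSup_rng (i := n) continuous_coinduced_rng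
  convert h3.comp (h2.comp h1) using 1
  funext t
  apply Subtype.ext
  simp only [Grassmannian.spanFrame, Grassmannian.incl, Function.comp_apply]
  rw [Submodule.map_span, ← Set.range_comp, hcomp]

/-- A condition `F v w = 0` imposed on all pairs of vectors of a plane is closed. -/
theorem isClosed_setOf_forall_mem_eq_zero (k : ℕ) (F : RInf → RInf → ℝ)
    (hF : ∀ n, Continuous fun p : (Fin n → ℝ) × (Fin n → ℝ) => F (inclRn n p.1) (inclRn n p.2)) :
    IsClosed {W : Grassmannian k RInf | ∀ v ∈ W.1, ∀ w ∈ W.1, F v w = 0} := by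
  refine isClosed_iSup_iff.2 fun n => isClosed_coinduced.2 <| isClosed_coinduced.2 ?_
  have : (Grassmannian.spanFrame ⁻¹' (Grassmannian.incl k n ⁻¹'
      {W : Grassmannian k RInf | ∀ v ∈ W.1, ∀ w ∈ W.1, F v w = 0}) :
      Set {f : Fin k → Fin n → ℝ // LinearIndependent ℝ f}) =
      ⋂ (x : Fin k → ℝ) (y : Fin k → ℝ), {f | F (inclRn n (∑ i, x i • f.1 i))
        (inclRn n (∑ i, y i • f.1 i)) = 0} := by
    ext f
    simp only [Set.mem_iInter, Set.mem_ofPred_eq]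
    change (∀ v ∈ (Submodule.span ℝ (Set.range f.1)).map (inclRn n),
      ∀ w ∈ (Submodule.span ℝ (Set.range f.1)).map (inclRn n), F v w = 0) ↔ _
    simp only [Submodule.mem_map, Submodule.mem_span_range_iff_exists_fun]
    constructor
    · intro h x y
      exact h _ ⟨_, ⟨x, rfl⟩, rfl⟩ _ ⟨_, ⟨y, rfl⟩, rfl⟩
    · rintro h _ ⟨_, ⟨x, rfl⟩, rfl⟩ _ ⟨_, ⟨y, rfl⟩, rfl⟩
      exact h x y
  rw [this]
  refine isClosed_iInter fun x => isClosed_iInter fun y => isClosed_eq ?_ continuous_const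
  have hsum : Continuous fun f : Fin k → Fin n → ℝ => (∑ i, x i • f i, ∑ i, y i • f i) := by
    fun_prop
  have hval : Continuous fun f : {f : Fin k → Fin n → ℝ // LinearIndependent ℝ f} => f.1 :=
    continuous_subtype_val
  have hcomp := (hF n).comp (hsum.comp hval)
  simpa only [Function.comp_def] using hcomp

theorem continuous_dotForm_inclRn (n : ℕ) (a : RInf) :
    Continuous fun x : Fin n → ℝ => dotForm (inclRn n x) a :=
  ((dotForm.flip a) ∘ₗ inclRn n).continuous_of_finiteDimensional

/-! ### Flats of the matroid of a plane -/

/-- `a` lies in the flat spanned by `S` in the matroid of `W`. -/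
def IsInFlat (W : Submodule ℝ RInf) (S : Set RInf) (a : RInf) : Prop :=
  ∀ w ∈ W, (∀ s ∈ S, dotForm w s = 0) → dotForm w a = 0

theorem isInFlat_of_matroidOf_eq {A : Set RInf} {V W : Submodule ℝ RInf}
    (h : matroidOf A W = matroidOf A V) {S : Set RInf} (hS : S ⊆ A) {a : RInf} (ha : a ∈ A)
    (hV : IsInFlat V S a) : IsInFlat W S a := by
  intro w hw hwS
  obtain ⟨v, hv, hvw⟩ : (fun a : A => dotInf w a ≠ 0) ∈ matroidOf A V := h ▸ ⟨w, hw, rfl⟩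
  have hiff : ∀ b ∈ A, (dotForm w b = 0 ↔ dotForm v b = 0) := fun b hb =>
    not_iff_not.1 (iff_of_eq (congrFun hvw ⟨b, hb⟩))
  exact (hiff a ha).2 (hV v hv fun s hs => (hiff s (hS hs)).1 (hwS s hs))

theorem isInFlat_iff_of_matroidOf_eq {A : Set RInf} {V W : Submodule ℝ RInf}
    (h : matroidOf A W = matroidOf A V) {S : Set RInf} (hS : S ⊆ A) {a : RInf} (ha : a ∈ A) :
    IsInFlat W S a ↔ IsInFlat V S a :=
  ⟨isInFlat_of_matroidOf_eq h.symm hS ha, isInFlat_of_matroidOf_eq h hS ha⟩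

theorem matroidOf_eq_of_orientedMatroidOf_eq {A : Set RInf} {V W : Submodule ℝ RInf}
    (h : orientedMatroidOf A W = orientedMatroidOf A V) : matroidOf A W = matroidOf A V := by
  have key : ∀ U : Submodule ℝ RInf, matroidOf A U =
      (fun (f : A → SignType) a => f a ≠ 0) '' orientedMatroidOf A U := by
    intro U
    ext f
    constructor
    · rintro ⟨v, hv, rfl⟩
      exact ⟨_, ⟨v, hv, rfl⟩, by funext a; simp⟩
    · rintro ⟨_, ⟨v, hv, rfl⟩, rfl⟩
      exact ⟨v, hv, by funext a; simp⟩
  rw [key, key, h]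

/-- The linear functional on `W` that a vector of `ℝ^∞` induces through the inner product. -/
noncomputable def toDual (W : Submodule ℝ RInf) : RInf →ₗ[ℝ] Module.Dual ℝ W :=
  (Module.Dual.transpose (R := ℝ) W.subtype) ∘ₗ dotForm.flip

theorem toDual_apply (W : Submodule ℝ RInf) (a : RInf) (w : W) :
    toDual W a w = dotForm w a := rfl

theorem isInFlat_iff {W : Submodule ℝ RInf} {S : Set RInf} (hS : S.Finite) {a : RInf} :
    IsInFlat W S a ↔ toDual W a ∈ Submodule.span ℝ (toDual W '' S) := by
  constructor
  · intro h
    have := hS.to_subtype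
    rw [Set.image_eq_range]
    refine mem_span_of_iInf_ker_le_ker fun (w : W) hw =>
      LinearMap.mem_ker.2 (h w.1 w.2 fun s hs => ?_)
    simp only [Submodule.mem_iInf] at hw
    exact hw ⟨s, hs⟩
  · intro h w hw hwS
    have hle : Submodule.span ℝ (toDual W '' S) ≤
        LinearMap.ker (Module.Dual.eval ℝ W ⟨w, hw⟩) := by
      rw [Submodule.span_le]
      rintro _ ⟨s, hs, rfl⟩
      exact hwS s hs
    exact hle h

theorem isInFlat_empty {W : Submodule ℝ RInf} {a : RInf} :
    IsInFlat W ∅ a ↔ toDual W a = 0 := by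
  simp [isInFlat_iff]

theorem isInFlat_singleton {W : Submodule ℝ RInf} {s a : RInf} :
    IsInFlat W {s} a ↔ ∃ x : ℝ, x • toDual W s = toDual W a := by
  simp [isInFlat_iff, Submodule.mem_span_singleton]

theorem isInFlat_pair {W : Submodule ℝ RInf} {s t a : RInf} :
    IsInFlat W {s, t} a ↔ ∃ x y : ℝ, x • toDual W s + y • toDual W t = toDual W a := by
  simp [isInFlat_iff, Set.image_pair, Submodule.mem_span_pair]

/-! ### The von Staudt construction -/

theorem coeff_eq_of_linearIndependent {E : Type} [AddCommGroup E] [Module ℝ E] {α β γ : E}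
    (h : LinearIndependent ℝ ![α, β, γ]) {x y z x' y' z' : ℝ}
    (he : x • α + y • β + z • γ = x' • α + y' • β + z' • γ) : x = x' ∧ y = y' ∧ z = z' := by
  have h0 := Fintype.linearIndependent_iff.1 h ![x - x', y - y', z - z'] (by
    simp only [Fin.sum_univ_three, Matrix.cons_val]
    linear_combination (norm := module) he)
  have h1 := h0 0
  have h2 := h0 1
  have h3 := h0 2
  simp only [Matrix.cons_val] at h1 h2 h3
  exact ⟨by linarith, by linarith, by linarith⟩

/-- In the affine chart with origin `α`, horizontal direction `β` and vertical direction `γ`, the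
points `P m` lie on the horizontal axis, the points `Q m` on the line at height one, `Q m` lies
above `P m`, and the line from `Q m` to `P (m + 1)` is parallel to the line from `Q 0` to `π`.
Hence `P m` is `m` times as far from the origin as `π`. -/
theorem exists_smul_add_nat_smul {E : Type} [AddCommGroup E] [Module ℝ E] {α β γ π d : E}
    {P Q : ℕ → E} {N : ℕ} (h : LinearIndependent ℝ ![α, β, γ])
    (hπ : ∃ x : ℝ, x ≠ 0 ∧ π = x • (α + β)) (hQ0 : ∃ z : ℝ, z ≠ 0 ∧ Q 0 = z • (α + γ))
    (hd : ∃ u v : ℝ, u • β + v • γ = d) (hd' : ∃ s r : ℝ, s • Q 0 + r • π = d) (hd0 : d ≠ 0)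
    (hP0 : ∃ x : ℝ, x • α = P 0) (hPne : ∀ m ≤ N, P m ≠ 0) (hQne : ∀ m ≤ N, Q m ≠ 0)
    (hP : ∀ m ≤ N, ∃ x y : ℝ, x • α + y • β = P m)
    (hQP : ∀ m ≤ N, ∃ x y : ℝ, x • P m + y • γ = Q m)
    (hQ : ∀ m ≤ N, ∃ x y : ℝ, x • Q 0 + y • β = Q m)
    (hPQ : ∀ m < N, ∃ x y : ℝ, x • Q m + y • d = P (m + 1)) :
    ∀ m ≤ N, ∃ s : ℝ, s ≠ 0 ∧ P m = s • (α + (m : ℝ) • β) := by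
  obtain ⟨x, hx, rfl⟩ := hπ
  obtain ⟨z, hz, hQ0⟩ := hQ0
  obtain ⟨ρ, rfl⟩ : ∃ ρ : ℝ, d = ρ • (β - γ) := by
    obtain ⟨u, v, huv⟩ := hd
    obtain ⟨s, r, hsr⟩ := hd'
    rw [hQ0, ← huv] at hsr
    obtain ⟨h1, h2, h3⟩ := coeff_eq_of_linearIndependent h (x := s * z + r * x) (y := r * x)
      (z := s * z) (x' := 0) (y' := u) (z' := v) (by linear_combination (norm := module) hsr)
    refine ⟨u, ?_⟩
    have hv : v = -u := by linarith
    rw [← huv, hv]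
    module
  have hρ : ρ ≠ 0 := by rintro rfl; simp at hd0
  intro m
  induction m with
  | zero =>
    intro hm
    obtain ⟨s, hs⟩ := hP0
    refine ⟨s, ?_, by simp [hs]⟩
    rintro rfl
    exact hPne 0 hm (by simp [← hs])
  | succ m ih =>
    intro hm
    obtain ⟨s, hs, hPm⟩ := ih (by omega)
    obtain ⟨a, b, hab⟩ := hQP m (by omega)
    obtain ⟨a', b', hab'⟩ := hQ m (by omega)
    obtain ⟨q, hq, hQm⟩ : ∃ q : ℝ, q ≠ 0 ∧ Q m = q • (α + (m : ℝ) • β + γ) := by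
      rw [← hab, hPm, hQ0] at hab'
      obtain ⟨h1, h2, h3⟩ := coeff_eq_of_linearIndependent h (x := a' * z) (y := b')
        (z := a' * z) (x' := a * s) (y' := a * s * m) (z' := b)
        (by linear_combination (norm := module) hab')
      have hQm : Q m = b • (α + (m : ℝ) • β + γ) := by
        have has : a * s = b := by linarith
        rw [← hab, hPm, ← has]
        module
      refine ⟨b, ?_, hQm⟩
      rintro rfl
      exact hQne m (by omega) (by simp [hQm])
    obtain ⟨c, c', hc⟩ := hPQ m (by omega)
    obtain ⟨e, e', he⟩ := hP (m + 1) hm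
    rw [hQm, ← he] at hc
    obtain ⟨h1, h2, h3⟩ := coeff_eq_of_linearIndependent h (x := c * q) (y := c * q * m + c' * ρ)
      (z := c * q - c' * ρ) (x' := e) (y' := e') (z' := 0)
      (by linear_combination (norm := module) hc)
    have he' : e' = e * (m + 1) := by rw [← h2, ← h1]; linarith
    have hPm1 : P (m + 1) = e • (α + ((m + 1 : ℕ) : ℝ) • β) := by
      rw [← he, he']
      push_cast
      module
    refine ⟨e, ?_, hPm1⟩
    rintro rfl
    exact hPne (m + 1) hm (by simp [hPm1])

theorem linearIndependent_of_not_isInFlat {W : Submodule ℝ RInf} {α β γ : RInf}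
    (hα : ¬ IsInFlat W {β, γ} α) (hβ : ¬ IsInFlat W {α, γ} β) (hγ : ¬ IsInFlat W {α, β} γ) :
    LinearIndependent ℝ ![toDual W α, toDual W β, toDual W γ] := by
  rw [isInFlat_pair] at hα hβ hγ
  rw [Fintype.linearIndependent_iff]
  intro g hg
  simp only [Fin.sum_univ_three, Matrix.cons_val] at hg
  have h0 : g 0 = 0 := by
    by_contra h
    refine hα ⟨-(g 1 / g 0), -(g 2 / g 0), ?_⟩
    linear_combination (norm := (match_scalars <;> field_simp <;> ring)) (-(g 0)⁻¹) • hg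
  have h1 : g 1 = 0 := by
    by_contra h
    refine hβ ⟨-(g 0 / g 1), -(g 2 / g 1), ?_⟩
    linear_combination (norm := (match_scalars <;> field_simp <;> ring)) (-(g 1)⁻¹) • hg
  have h2 : g 2 = 0 := by
    by_contra h
    refine hγ ⟨-(g 0 / g 2), -(g 1 / g 2), ?_⟩
    linear_combination (norm := (match_scalars <;> field_simp <;> ring)) (-(g 2)⁻¹) • hg
  intro i
  fin_cases i
  exacts [h0, h1, h2]

/-- The coordinates, in a plane `V`, of the vectors used in the von Staudt construction of the
point at distance `j` from the origin: `α`, `β`, `γ` are independent on `V`, and the functionals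
that the other vectors induce on `V` are the stated combinations of `α`, `β`, `γ`. The point `ρ`
represents `(1, j, 0)` up to the factor `j⁻¹`, and the auxiliary points `P m`, `Q m` carry a common
factor `t`. -/
structure IsVonStaudtConfig (V : Submodule ℝ RInf) (α β γ π ρ d : RInf) (P Q : ℕ → RInf) (j : ℕ)
    (t : ℝ) : Prop where
  dual_α : ∃ v ∈ V, dotForm v α = 1 ∧ dotForm v β = 0 ∧ dotForm v γ = 0
  dual_β : ∃ v ∈ V, dotForm v α = 0 ∧ dotForm v β = 1 ∧ dotForm v γ = 0
  dual_γ : ∃ v ∈ V, dotForm v α = 0 ∧ dotForm v β = 0 ∧ dotForm v γ = 1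
  eq_π : ∀ v ∈ V, dotForm v π = dotForm v α + dotForm v β
  eq_ρ : ∀ v ∈ V, dotForm v ρ = (j : ℝ)⁻¹ * dotForm v α + dotForm v β
  eq_d : ∀ v ∈ V, dotForm v d = dotForm v β - dotForm v γ
  eq_P : ∀ m ≤ j, ∀ v ∈ V, dotForm v (P m) = t * (dotForm v α + m * dotForm v β)
  eq_Q : ∀ m ≤ j, ∀ v ∈ V, dotForm v (Q m) = t * (dotForm v α + m * dotForm v β + dotForm v γ)

/-- The `2 × 2` minor of the inner products of `v`, `w` with `a`, `b`. -/
noncomputable def minor (a b v w : RInf) : ℝ :=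
  dotForm v a * dotForm w b - dotForm v b * dotForm w a

/-- The equation saying that the cross ratio of the points that `α`, `β`, `π`, `ρ` induce on a
plane is `j`, with denominators cleared. -/
noncomputable def crossRatioDefect (α β π ρ : RInf) (j : ℕ) (v w : RInf) : ℝ :=
  minor α ρ v w * minor β π v w - j * (minor α π v w * minor β ρ v w)

/-- On a plane with the same matroid as a von Staudt configuration, the cross ratio is `j`. -/
theorem IsVonStaudtConfig.crossRatioDefect_eq_zero {A : Set RInf} {V W : Submodule ℝ RInf}
    {α β γ π ρ d : RInf} {P Q : ℕ → RInf} {j : ℕ} {t : ℝ}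
    (hV : IsVonStaudtConfig V α β γ π ρ d P Q j t) (ht : t ≠ 0) (hj : 0 < j)
    (hα : α ∈ A) (hβ : β ∈ A) (hγ : γ ∈ A) (hπ : π ∈ A) (hρ : ρ ∈ A) (hd : d ∈ A)
    (hP : ∀ m ≤ j, P m ∈ A) (hQ : ∀ m ≤ j, Q m ∈ A) (h : matroidOf A W = matroidOf A V) :
    ∀ v ∈ W, ∀ w ∈ W, crossRatioDefect α β π ρ j v w = 0 := by
  have pair : ∀ {x y z}, x ∈ A → y ∈ A → z ∈ A → (IsInFlat W {x, y} z ↔ IsInFlat V {x, y} z) :=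
    fun hx hy hz => isInFlat_iff_of_matroidOf_eq h (Set.pair_subset hx hy) hz
  have single : ∀ {x z}, x ∈ A → z ∈ A → (IsInFlat W {x} z ↔ IsInFlat V {x} z) :=
    fun hx hz => isInFlat_iff_of_matroidOf_eq h (Set.singleton_subset_iff.2 hx) hz
  have empty : ∀ {z}, z ∈ A → (IsInFlat W ∅ z ↔ IsInFlat V ∅ z) :=
    fun hz => isInFlat_iff_of_matroidOf_eq h (Set.empty_subset _) hz
  have hj' : (j : ℝ) ≠ 0 := by positivity
  have eP0 : ∀ v ∈ V, dotForm v (P 0) = t * dotForm v α := fun v hv => by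
    simpa using hV.eq_P 0 (Nat.zero_le _) v hv
  have eQ0 : ∀ v ∈ V, dotForm v (Q 0) = t * (dotForm v α + dotForm v γ) := fun v hv => by
    simpa using hV.eq_Q 0 (Nat.zero_le _) v hv
  obtain ⟨v₀, hv₀, a₀, b₀, c₀⟩ := hV.dual_α
  obtain ⟨v₁, hv₁, a₁, b₁, c₁⟩ := hV.dual_β
  obtain ⟨v₂, hv₂, a₂, b₂, c₂⟩ := hV.dual_γ
  have hind : LinearIndependent ℝ ![toDual W α, toDual W β, toDual W γ] := by
    refine linearIndependent_of_not_isInFlat ?_ ?_ ?_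
    · rw [pair hβ hγ hα]
      intro hf
      simpa [a₀] using hf v₀ hv₀ (by simp [b₀, c₀])
    · rw [pair hα hγ hβ]
      intro hf
      simpa [b₁] using hf v₁ hv₁ (by simp [a₁, c₁])
    · rw [pair hα hβ hγ]
      intro hf
      simpa [c₂] using hf v₂ hv₂ (by simp [a₂, b₂])
  -- Normalize the frame so that `π` and `Q 0` become unit points of the axes.
  obtain ⟨x, y, hxy⟩ : ∃ x y : ℝ, x • toDual W α + y • toDual W β = toDual W π := by
    rw [← isInFlat_pair, pair hα hβ hπ]
    intro v hv h0
    simp [hV.eq_π v hv, h0 α (by simp), h0 β (by simp)]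
  have hx : x ≠ 0 := by
    rintro rfl
    have hf : IsInFlat W {β} π := isInFlat_singleton.2 ⟨y, by simp [← hxy]⟩
    rw [single hβ hπ] at hf
    simpa [hV.eq_π v₀ hv₀, a₀, b₀] using hf v₀ hv₀ (by simp [b₀])
  have hy : y ≠ 0 := by
    rintro rfl
    have hf : IsInFlat W {α} π := isInFlat_singleton.2 ⟨x, by simp [← hxy]⟩
    rw [single hα hπ] at hf
    simpa [hV.eq_π v₁ hv₁, a₁, b₁] using hf v₁ hv₁ (by simp [a₁])
  have hQ0 := hQ 0 (Nat.zero_le _)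
  obtain ⟨z, u, hzu⟩ : ∃ z u : ℝ, z • toDual W α + u • toDual W γ = toDual W (Q 0) := by
    rw [← isInFlat_pair, pair hα hγ hQ0]
    intro v hv h0
    simp [eQ0 v hv, h0 α (by simp), h0 γ (by simp)]
  have hz : z ≠ 0 := by
    rintro rfl
    have hf : IsInFlat W {γ} (Q 0) := isInFlat_singleton.2 ⟨u, by simp [← hzu]⟩
    rw [single hγ hQ0] at hf
    simpa [eQ0 v₀ hv₀, a₀, c₀, ht] using hf v₀ hv₀ (by simp [c₀])
  have hu : u ≠ 0 := by
    rintro rfl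
    have hf : IsInFlat W {α} (Q 0) := isInFlat_singleton.2 ⟨z, by simp [← hzu]⟩
    rw [single hα hQ0] at hf
    simpa [eQ0 v₂ hv₂, a₂, c₂, ht] using hf v₂ hv₂ (by simp [a₂])
  set β' := (y / x) • toDual W β with hβ'
  set γ' := (u / z) • toDual W γ with hγ'
  have hβs : toDual W β = (x / y) • β' := by rw [hβ', smul_smul]; field_simp; simp
  have hγs : toDual W γ = (z / u) • γ' := by rw [hγ', smul_smul]; field_simp; simp
  have hind' : LinearIndependent ℝ ![toDual W α, β', γ'] := by
    rw [Fintype.linearIndependent_iff]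
    intro g hg
    simp only [Fin.sum_univ_three, Matrix.cons_val] at hg
    obtain ⟨h1, h2, h3⟩ := coeff_eq_of_linearIndependent hind (x := g 0) (y := g 1 * (y / x))
      (z := g 2 * (u / z)) (x' := 0) (y' := 0) (z' := 0)
      (by rw [mul_smul, mul_smul, ← hβ', ← hγ', hg]; simp)
    intro i
    fin_cases i
    · exact h1
    · exact (mul_eq_zero.1 h2).resolve_right (div_ne_zero hy hx)
    · exact (mul_eq_zero.1 h3).resolve_right (div_ne_zero hu hz)
  have hchain := exists_smul_add_nat_smul (π := toDual W π) (d := toDual W d)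
    (P := fun m => toDual W (P m)) (Q := fun m => toDual W (Q m)) (N := j) hind'
    ⟨x, hx, by rw [← hxy, hβs]; match_scalars <;> field_simp⟩
    ⟨z, hz, by rw [← hzu, hγs]; match_scalars <;> field_simp⟩
    (by
      obtain ⟨p, q, hpq⟩ : ∃ p q : ℝ, p • toDual W β + q • toDual W γ = toDual W d := by
        rw [← isInFlat_pair, pair hβ hγ hd]
        intro v hv h0
        simp [hV.eq_d v hv, h0 β (by simp), h0 γ (by simp)]
      exact ⟨p * (x / y), q * (z / u), by rw [mul_smul, mul_smul, ← hβs, ← hγs, hpq]⟩)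
    (by
      rw [← isInFlat_pair, pair hQ0 hπ hd]
      intro v hv h0
      have h1 := h0 (Q 0) (by simp)
      have h2 := h0 π (by simp)
      rw [eQ0 v hv] at h1
      rw [hV.eq_π v hv] at h2
      have h3 := (mul_eq_zero.1 h1).resolve_left ht
      rw [hV.eq_d v hv]
      linarith)
    (by
      rw [Ne, ← isInFlat_empty, empty hd]
      intro hf
      simpa [hV.eq_d v₁ hv₁, b₁, c₁] using hf v₁ hv₁ (by simp))
    (by
      rw [← isInFlat_singleton, single hα (hP 0 (Nat.zero_le _))]
      intro v hv h0
      simp [eP0 v hv, h0 α rfl])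
    (by
      intro m hm
      rw [Ne, ← isInFlat_empty, empty (hP m hm)]
      intro hf
      simpa [hV.eq_P m hm v₀ hv₀, a₀, b₀, ht] using hf v₀ hv₀ (by simp))
    (by
      intro m hm
      rw [Ne, ← isInFlat_empty, empty (hQ m hm)]
      intro hf
      simpa [hV.eq_Q m hm v₀ hv₀, a₀, b₀, c₀, ht] using hf v₀ hv₀ (by simp))
    (by
      intro m hm
      obtain ⟨p, q, hpq⟩ : ∃ p q : ℝ, p • toDual W α + q • toDual W β = toDual W (P m) := by
        rw [← isInFlat_pair, pair hα hβ (hP m hm)]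
        intro v hv h0
        simp [hV.eq_P m hm v hv, h0 α (by simp), h0 β (by simp)]
      exact ⟨p, q * (x / y), by rw [mul_smul, ← hβs, hpq]⟩)
    (by
      intro m hm
      obtain ⟨p, q, hpq⟩ : ∃ p q : ℝ,
          p • toDual W (P m) + q • toDual W γ = toDual W (Q m) := by
        rw [← isInFlat_pair, pair (hP m hm) hγ (hQ m hm)]
        intro v hv h0
        have h1 := h0 (P m) (by simp)
        have h2 := h0 γ (by simp)
        rw [hV.eq_P m hm v hv] at h1
        rw [hV.eq_Q m hm v hv, h2, add_zero, h1]
      exact ⟨p, q * (z / u), by rw [mul_smul, ← hγs, hpq]⟩)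
    (by
      intro m hm
      obtain ⟨p, q, hpq⟩ : ∃ p q : ℝ,
          p • toDual W (Q 0) + q • toDual W β = toDual W (Q m) := by
        rw [← isInFlat_pair, pair hQ0 hβ (hQ m hm)]
        intro v hv h0
        have h1 := h0 (Q 0) (by simp)
        have h2 := h0 β (by simp)
        rw [eQ0 v hv] at h1
        rw [hV.eq_Q m hm v hv, h2, mul_zero, add_zero, h1]
      exact ⟨p, q * (x / y), by rw [mul_smul, ← hβs, hpq]⟩)
    (by
      intro m hm
      rw [← isInFlat_pair, pair (hQ m hm.le) hd (hP (m + 1) hm)]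
      intro v hv h0
      have h1 := h0 (Q m) (by simp)
      have h2 := h0 d (by simp)
      rw [hV.eq_Q m hm.le v hv] at h1
      rw [hV.eq_d v hv] at h2
      rw [hV.eq_P (m + 1) hm v hv]
      push_cast
      linear_combination h1 + t * h2)
    j le_rfl
  obtain ⟨s, -, hPj⟩ := hchain
  obtain ⟨p, hp⟩ : ∃ p : ℝ, p • toDual W (P j) = toDual W ρ := by
    rw [← isInFlat_singleton, single (hP j le_rfl) hρ]
    intro v hv h0
    have h1 := h0 (P j) rfl
    rw [hV.eq_P j le_rfl v hv] at h1
    have h2 := (mul_eq_zero.1 h1).resolve_left ht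
    rw [hV.eq_ρ v hv]
    field_simp
    linarith
  intro v hv w hw
  have eπ : ∀ v ∈ W, dotForm v π = x * dotForm v α + y * dotForm v β := fun v hv =>
    (LinearMap.congr_fun hxy ⟨v, hv⟩).symm
  have eρ : ∀ v ∈ W, dotForm v ρ = p * (s * (dotForm v α + j * (y / x * dotForm v β))) :=
    fun v hv => by
      have h1 := LinearMap.congr_fun hp ⟨v, hv⟩
      have h2 := LinearMap.congr_fun hPj ⟨v, hv⟩
      rw [LinearMap.smul_apply, h2] at h1
      exact h1.symm
  simp only [crossRatioDefect, minor, eπ v hv, eπ w hw, eρ v hv, eρ w hw]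
  field_simp
  ring

/-- A von Staudt configuration has cross ratio `j`, and no other one. -/
theorem IsVonStaudtConfig.eq_of_crossRatioDefect_eq_zero {V : Submodule ℝ RInf}
    {α β γ π ρ d : RInf} {P Q : ℕ → RInf} {j l : ℕ} {t : ℝ}
    (hV : IsVonStaudtConfig V α β γ π ρ d P Q l t) (hl : 0 < l)
    (h : ∀ v ∈ V, ∀ w ∈ V, crossRatioDefect α β π ρ j v w = 0) : l = j := by
  obtain ⟨v₀, hv₀, a₀, b₀, c₀⟩ := hV.dual_α
  obtain ⟨v₁, hv₁, a₁, b₁, c₁⟩ := hV.dual_β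
  have h1 := h v₀ hv₀ v₁ hv₁
  simp only [crossRatioDefect, minor, hV.eq_π v₀ hv₀, hV.eq_π v₁ hv₁, hV.eq_ρ v₀ hv₀,
    hV.eq_ρ v₁ hv₁, a₀, b₀, a₁, b₁] at h1
  have hl' : (l : ℝ) ≠ 0 := by positivity
  field_simp at h1
  have h2 : (l : ℝ) = j := by linarith
  exact_mod_cast h2

theorem isClosed_crossRatioDefect (k : ℕ) (α β π ρ : RInf) (j : ℕ) :
    IsClosed {W : Grassmannian k RInf |
      ∀ v ∈ W.1, ∀ w ∈ W.1, crossRatioDefect α β π ρ j v w = 0} := by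
  refine isClosed_setOf_forall_mem_eq_zero k _ fun n => ?_
  have h1 : ∀ a, Continuous fun p : (Fin n → ℝ) × (Fin n → ℝ) => dotForm (inclRn n p.1) a :=
    fun a => (continuous_dotForm_inclRn n a).comp continuous_fst
  have h2 : ∀ a, Continuous fun p : (Fin n → ℝ) × (Fin n → ℝ) => dotForm (inclRn n p.2) a :=
    fun a => (continuous_dotForm_inclRn n a).comp continuous_snd
  have hm : ∀ a b, Continuous fun p : (Fin n → ℝ) × (Fin n → ℝ) =>
      minor a b (inclRn n p.1) (inclRn n p.2) := fun a b =>
    ((h1 a).mul (h2 b)).sub ((h1 b).mul (h2 a))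
  exact ((hm _ _).mul (hm _ _)).sub (continuous_const.mul ((hm _ _).mul (hm _ _)))

/-! ### Planes carrying a von Staudt configuration -/

theorem dotForm_eq_zero_of_mem_span_range {k : ℕ} {F : Fin k → RInf} {a : RInf}
    (h : ∀ i, dotForm (F i) a = 0) : ∀ v ∈ Submodule.span ℝ (Set.range F), dotForm v a = 0 := by
  have hle : Submodule.span ℝ (Set.range F) ≤ LinearMap.ker (dotForm.flip a) := by
    rw [Submodule.span_le]
    rintro _ ⟨i, rfl⟩
    exact h i
  exact fun v hv => hle hv

theorem isVonStaudtConfig_span_range {k : ℕ} (hk : 3 ≤ k) {F : Fin k → RInf} {α β γ π ρ d : RInf}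
    {P Q : ℕ → RInf} {j : ℕ} {t : ℝ}
    (hα : ∀ i : Fin k, dotForm (F i) α = if (i : ℕ) = 0 then 1 else 0)
    (hβ : ∀ i : Fin k, dotForm (F i) β = if (i : ℕ) = 1 then 1 else 0)
    (hγ : ∀ i : Fin k, dotForm (F i) γ = if (i : ℕ) = 2 then 1 else 0)
    (hπ : ∀ i : Fin k, dotForm (F i) π = if (i : ℕ) = 0 then 1 else if (i : ℕ) = 1 then 1 else 0)
    (hρ : ∀ i : Fin k, dotForm (F i) ρ =
      if (i : ℕ) = 0 then (j : ℝ)⁻¹ else if (i : ℕ) = 1 then 1 else 0)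
    (hd : ∀ i : Fin k, dotForm (F i) d = if (i : ℕ) = 1 then 1 else if (i : ℕ) = 2 then -1 else 0)
    (hP : ∀ m ≤ j, ∀ i : Fin k, dotForm (F i) (P m) =
      if (i : ℕ) = 0 then t else if (i : ℕ) = 1 then t * m else 0)
    (hQ : ∀ m ≤ j, ∀ i : Fin k, dotForm (F i) (Q m) =
      if (i : ℕ) = 0 then t else if (i : ℕ) = 1 then t * m else if (i : ℕ) = 2 then t else 0) :
    IsVonStaudtConfig (Submodule.span ℝ (Set.range F)) α β γ π ρ d P Q j t where
  dual_α := ⟨F ⟨0, by omega⟩, Submodule.subset_span ⟨_, rfl⟩, by simp [hα], by simp [hβ],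
    by simp [hγ]⟩
  dual_β := ⟨F ⟨1, by omega⟩, Submodule.subset_span ⟨_, rfl⟩, by simp [hα], by simp [hβ],
    by simp [hγ]⟩
  dual_γ := ⟨F ⟨2, by omega⟩, Submodule.subset_span ⟨_, rfl⟩, by simp [hα], by simp [hβ],
    by simp [hγ]⟩
  eq_π v hv := by
    have := dotForm_eq_zero_of_mem_span_range (a := π - (α + β)) (fun i => by
      simp only [map_sub, map_add, hπ, hα, hβ]
      split_ifs <;> first | omega | simp) v hv
    simp only [map_sub, map_add] at this
    linarith
  eq_ρ v hv := by
    have := dotForm_eq_zero_of_mem_span_range (a := ρ - ((j : ℝ)⁻¹ • α + β)) (fun i => by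
      simp only [map_sub, map_add, map_smul, smul_eq_mul, hρ, hα, hβ]
      split_ifs <;> first | omega | simp) v hv
    simp only [map_sub, map_add, map_smul, smul_eq_mul] at this
    linarith
  eq_d v hv := by
    have := dotForm_eq_zero_of_mem_span_range (a := d - (β - γ)) (fun i => by
      simp only [map_sub, hd, hβ, hγ]
      split_ifs <;> first | omega | simp) v hv
    simp only [map_sub] at this
    linarith
  eq_P m hm v hv := by
    have := dotForm_eq_zero_of_mem_span_range (a := P m - t • (α + (m : ℝ) • β)) (fun i => by
      simp only [map_sub, map_add, map_smul, smul_eq_mul, hP m hm, hα, hβ]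
      split_ifs <;> first | omega | simp) v hv
    simp only [map_sub, map_add, map_smul, smul_eq_mul] at this
    linarith
  eq_Q m hm v hv := by
    have := dotForm_eq_zero_of_mem_span_range (a := Q m - t • (α + (m : ℝ) • β + γ)) (fun i => by
      simp only [map_sub, map_add, map_smul, smul_eq_mul, hQ m hm, hα, hβ, hγ]
      split_ifs <;> first | omega | simp) v hv
    simp only [map_sub, map_add, map_smul, smul_eq_mul] at this
    linarith

theorem linearIndependent_of_dotForm_eq {k : ℕ} {F b : Fin k → RInf}
    (h : ∀ i l, dotForm (F i) (b l) = if l = i then 1 else 0) : LinearIndependent ℝ F := by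
  rw [Fintype.linearIndependent_iff]
  intro g hg l
  have := congrArg (fun v => dotForm v (b l)) hg
  simpa [map_sum, h] using this

/-- Positive rescaling of the part `g` of a frame `f + t • g` preserves the oriented matroid on a
ground set each of whose elements is orthogonal to all `f i` or to all `g i`. -/
theorem orientedMatroidOf_span_add_smul {k : ℕ} {f g : Fin k → RInf} {A : Set RInf}
    (hA : ∀ a ∈ A, (∀ i, dotForm (f i) a = 0) ∨ ∀ i, dotForm (g i) a = 0) {t t' : ℝ}
    (ht : 0 < t) (ht' : 0 < t') :
    orientedMatroidOf A (Submodule.span ℝ (Set.range fun i => f i + t • g i)) =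
      orientedMatroidOf A (Submodule.span ℝ (Set.range fun i => f i + t' • g i)) := by
  have key : ∀ t t' : ℝ, 0 < t → 0 < t' →
      orientedMatroidOf A (Submodule.span ℝ (Set.range fun i => f i + t • g i)) ⊆
      orientedMatroidOf A (Submodule.span ℝ (Set.range fun i => f i + t' • g i)) := by
    rintro t t' ht ht' _ ⟨v, hv, rfl⟩
    obtain ⟨x, rfl⟩ := (Submodule.mem_span_range_iff_exists_fun ℝ).1 hv
    refine ⟨∑ i, x i • (f i + t' • g i),
      (Submodule.mem_span_range_iff_exists_fun ℝ).2 ⟨x, rfl⟩, ?_⟩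
    funext ⟨a, ha⟩
    have hval : ∀ s : ℝ, dotInf (∑ i, x i • (f i + s • g i)) a =
        ∑ i, x i * dotForm (f i) a + s * ∑ i, x i * dotForm (g i) a := fun s => by
      rw [← dotForm_apply, Finset.mul_sum, ← Finset.sum_add_distrib]
      simp only [map_sum, map_smul, map_add, LinearMap.sum_apply, LinearMap.smul_apply,
        LinearMap.add_apply, smul_eq_mul]
      exact Finset.sum_congr rfl fun i _ => by ring
    simp only [hval]
    rcases hA a ha with h | h
    · simp [h, sign_mul, sign_pos ht, sign_pos ht']
    · simp [h]
  exact (key t t' ht ht').antisymm (key t' t ht' ht)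

namespace IsCompatibleSequence

variable {A : ℕ → Set RInf}

theorem monotone (hA : IsCompatibleSequence A) : Monotone A := monotone_nat_of_le_succ hA.mono

theorem apply_eq_zero (hA : IsCompatibleSequence A) {M : ℕ} {a : RInf} (ha : ∃ n, a ∈ A n)
    (haM : a ∉ A M) : ∀ j < M, a j = 0 := by
  classical
  have hlt : M < Nat.find ha := by
    by_contra h
    exact haM (hA.monotone (not_lt.1 h) (Nat.find_spec ha))
  obtain ⟨n, hn⟩ : ∃ n, Nat.find ha = n + 1 := ⟨Nat.find ha - 1, by omega⟩
  have h1 : a ∈ A (n + 1) := hn ▸ Nat.find_spec ha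
  have h2 : a ∉ A n := Nat.find_min ha (by omega)
  exact fun j hj => hA.coord_eq_zero n a ⟨h1, h2⟩ j (by omega)

theorem exists_forall_mem (hA : IsCompatibleSequence A) {b : ℕ → RInf}
    (hb : ∀ r, b r ∈ ⋃ i, A i) (N : ℕ) : ∃ i, ∀ r < N, b r ∈ A i := by
  have hb' : ∀ r, ∃ i, b r ∈ A i := fun r => Set.mem_iUnion.1 (hb r)
  choose n hn using hb'
  refine ⟨(Finset.range N).sup n, fun r hr => hA.monotone ?_ (hn r)⟩
  exact Finset.le_sup (Finset.mem_range.2 hr)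

/-- There are planes `x j`, converging as `j → ∞`, such that `x j` has cross ratio `j + 1` at four
fixed elements of the ground set and is a limit of planes `y j m` that lie in a single oriented
matroid stratum; the cross ratio is `j + 1` on the whole matroid stratum of the latter. -/
theorem exists_separating {k : ℕ} (hk : 3 ≤ k) (hA : IsCompatibleSequence A) :
    ∃ (x : ℕ → Grassmannian k RInf) (z : Grassmannian k RInf) (C : ℕ → Set (Grassmannian k RInf))
      (y : ℕ → ℕ → Grassmannian k RInf), Tendsto x atTop (𝓝 z) ∧ (∀ j, IsClosed (C j)) ∧
      (∀ j, Tendsto (y j) atTop (𝓝 (x j))) ∧ (∀ j l, x l ∈ C j → l = j) ∧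
      (∀ j m i, orientedMatroidOf (A i) (y j m).1 = orientedMatroidOf (A i) (y j 0).1) ∧
      ∀ j W, (∀ i, matroidOf (A i) W.1 = matroidOf (A i) (y j 0).1) → W ∈ C j := by
  obtain ⟨b, hbA, hb⟩ := exists_seq_dotForm_eq hA.span_eq_top Set.finite_empty
  -- The frame `u + s • w` gives `b 0, …, b (k - 1)` the standard coordinates; the points `π = b k`,
  -- `ρ = b (k + 1)`, `d = b (k + 2)` get `(1, 1, 0)`, `(s, 1, 0)`, `(0, 1, -1)`. The point `ρ` is
  -- normalized in its second coordinate so that it converges as its cross ratio `s⁻¹` grows.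
  choose u _ hu using fun i : Fin k => hb (k + 3) fun r =>
    if r < k then (if r = i then 1 else 0)
    else if r = k then (if (i : ℕ) = 0 then 1 else if (i : ℕ) = 1 then 1 else 0)
    else if r = k + 1 then (if (i : ℕ) = 1 then 1 else 0)
    else (if (i : ℕ) = 1 then 1 else if (i : ℕ) = 2 then -1 else 0)
  choose w _ hw using fun i : Fin k => hb (k + 3) fun r =>
    if r = k + 1 then (if (i : ℕ) = 0 then 1 else 0) else 0
  obtain ⟨I, hI⟩ := hA.exists_forall_mem hbA (k + 3)
  obtain ⟨n, hn⟩ := exists_forall_le_apply_eq_zero (Sum.elim u w)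
  -- Every element of the ground set outside `A M` is orthogonal to all `u i` and `w i`.
  let M := max I n
  have hbM : ∀ r < k + 3, b r ∈ A M := fun r hr => hA.monotone (le_max_left _ _) (hI r hr)
  have huM : ∀ a, (∃ n, a ∈ A n) → a ∉ A M → ∀ i, dotForm (u i) a = 0 := fun a ha haM i =>
    dotForm_eq_zero_of_disjoint (fun j hj => hn (.inl i) j ((le_max_right _ _).trans hj))
      (hA.apply_eq_zero ha haM)
  have hwM : ∀ a, (∃ n, a ∈ A n) → a ∉ A M → ∀ i, dotForm (w i) a = 0 := fun a ha haM i =>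
    dotForm_eq_zero_of_disjoint (fun j hj => hn (.inr i) j ((le_max_right _ _).trans hj))
      (hA.apply_eq_zero ha haM)
  obtain ⟨c, hcA, hc⟩ := exists_seq_dotForm_eq hA.span_eq_top (hA.finite M)
  have hcM : ∀ r, c r ∉ A M := fun r hr => by
    obtain ⟨h, h0, h1⟩ := hc (r + 1) fun _ => 1
    have := h1 r (Nat.lt_succ_self r)
    rw [h0 _ hr] at this
    exact zero_ne_one this
  have huc : ∀ i r, dotForm (u i) (c r) = 0 := fun i r =>
    huM _ (Set.mem_iUnion.1 (hcA r)) (hcM r) i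
  have hwc : ∀ i r, dotForm (w i) (c r) = 0 := fun i r =>
    hwM _ (Set.mem_iUnion.1 (hcA r)) (hcM r) i
  -- The points `P m = c (2 * m)` and `Q m = c (2 * m + 1)` get coordinates `(1, m, 0)`, `(1, m, 1)`.
  choose g hgM hgc using fun (j : ℕ) (i : Fin k) => hc (2 * (j + 1) + 2) fun r =>
    if (i : ℕ) = 0 then 1 else if (i : ℕ) = 1 then ((r / 2 : ℕ) : ℝ)
    else if (i : ℕ) = 2 then ((r % 2 : ℕ) : ℝ) else 0
  have hgb : ∀ j i, ∀ r < k + 3, dotForm (g j i) (b r) = 0 := fun j i r hr =>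
    hgM j i _ (hbM r hr)
  have hind : ∀ (j : ℕ) (s t : ℝ), LinearIndependent ℝ fun i => (u i + s • w i) + t • g j i := by
    intro j s t
    refine linearIndependent_of_dotForm_eq (b := fun l => b l) fun i l => ?_
    have hl := l.2
    simp only [map_add, map_smul, LinearMap.add_apply, LinearMap.smul_apply, smul_eq_mul]
    rw [hgb _ _ _ (by omega), hu _ _ (by omega), hw _ _ (by omega)]
    simp [Fin.ext_iff, show (l : ℕ) ≠ k + 1 by omega]
  have hind' : ∀ s : ℝ, LinearIndependent ℝ fun i => u i + s • w i := fun s => by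
    simpa using hind 0 s 0
  have hconf : ∀ (j : ℕ) (t : ℝ), IsVonStaudtConfig
      (Submodule.span ℝ (Set.range fun i => (u i + ((j + 1 : ℕ) : ℝ)⁻¹ • w i) + t • g j i))
      (b 0) (b 1) (b 2) (b k) (b (k + 1)) (b (k + 2)) (fun m => c (2 * m))
      (fun m => c (2 * m + 1)) (j + 1) t := by
    intro j t
    have hbr : ∀ i, ∀ r < k + 3, dotForm ((u i + ((j + 1 : ℕ) : ℝ)⁻¹ • w i) + t • g j i) (b r) =
        dotForm (u i) (b r) + ((j + 1 : ℕ) : ℝ)⁻¹ * dotForm (w i) (b r) := fun i r hr => by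
      simp only [map_add, map_smul, LinearMap.add_apply, LinearMap.smul_apply, smul_eq_mul,
        hgb j i r hr, mul_zero, add_zero]
    have hcr : ∀ i r, dotForm ((u i + ((j + 1 : ℕ) : ℝ)⁻¹ • w i) + t • g j i) (c r) =
        t * dotForm (g j i) (c r) := fun i r => by
      simp only [map_add, map_smul, LinearMap.add_apply, LinearMap.smul_apply, smul_eq_mul,
        huc, hwc, mul_zero, add_zero, zero_add]
    apply isVonStaudtConfig_span_range hk
    · intro i
      rw [hbr i _ (by omega), hu i _ (by omega), hw i _ (by omega)]
      simp [show 0 < k by omega, eq_comm]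
    · intro i
      rw [hbr i _ (by omega), hu i _ (by omega), hw i _ (by omega)]
      simp [show 1 < k by omega, show k ≠ 0 by omega, eq_comm]
    · intro i
      rw [hbr i _ (by omega), hu i _ (by omega), hw i _ (by omega)]
      simp [show 2 < k by omega, show 2 ≠ k + 1 by omega, eq_comm]
    · intro i
      rw [hbr i _ (by omega), hu i _ (by omega), hw i _ (by omega)]
      simp
    · intro i
      rw [hbr i _ (by omega), hu i _ (by omega), hw i _ (by omega)]
      simp only [show ¬ k + 1 < k by omega, show k + 1 ≠ k by omega, if_false, if_true]
      split_ifs <;> first | omega | simp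
    · intro i
      rw [hbr i _ (by omega), hu i _ (by omega), hw i _ (by omega)]
      simp
    · intro m hm i
      rw [hcr, hgc j i _ (by omega)]
      simp
    · intro m hm i
      rw [hcr, hgc j i _ (by omega)]
      simp [show (2 * m + 1) / 2 = m by omega]
  let x : ℝ → Grassmannian k RInf := fun s => Grassmannian.spanFrame ⟨_, hind' s⟩
  let y : ℕ → ℝ → Grassmannian k RInf := fun j t =>
    Grassmannian.spanFrame ⟨_, hind j ((j + 1 : ℕ) : ℝ)⁻¹ t⟩
  have hy0 : ∀ j : ℕ, y j 0 = x ((j + 1 : ℕ) : ℝ)⁻¹ := fun j => by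
    apply Subtype.ext
    simp [x, y, Grassmannian.spanFrame]
  have hinv : Tendsto (fun m : ℕ => ((m + 1 : ℕ) : ℝ)⁻¹) atTop (𝓝 0) :=
    tendsto_inv_atTop_zero.comp
      (tendsto_natCast_atTop_atTop.comp (tendsto_add_atTop_nat 1))
  refine ⟨fun j => x ((j + 1 : ℕ) : ℝ)⁻¹, x 0, fun j => {W | ∀ v ∈ W.1, ∀ w ∈ W.1,
    crossRatioDefect (b 0) (b 1) (b k) (b (k + 1)) (j + 1) v w = 0},
    fun j m => y j ((m + 1 : ℕ) : ℝ)⁻¹, ?_, fun j => isClosed_crossRatioDefect _ _ _ _ _ _,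
    fun j => ?_, fun j l hl => ?_, fun j m i => ?_, fun j W hW => ?_⟩
  · exact ((continuous_spanFrame_add_smul u w hind').tendsto 0).comp hinv
  · beta_reduce
    rw [← hy0]
    exact ((continuous_spanFrame_add_smul _ _ (hind j ((j + 1 : ℕ) : ℝ)⁻¹)).tendsto 0).comp hinv
  · beta_reduce at hl
    rw [← hy0] at hl
    have := (hconf l 0).eq_of_crossRatioDefect_eq_zero (Nat.succ_pos l) hl
    omega
  · refine orientedMatroidOf_span_add_smul (fun a ha => ?_) (by positivity) (by positivity)
    by_cases haM : a ∈ A M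
    · exact Or.inr fun i => hgM j i a haM
    · refine Or.inl fun i => ?_
      simp [huM a ⟨_, ha⟩ haM, hwM a ⟨_, ha⟩ haM]
  · obtain ⟨I', hI'⟩ := hA.exists_forall_mem hcA (2 * (j + 1) + 2)
    have hb' : ∀ r < k + 3, b r ∈ A (max M I') := fun r hr =>
      hA.monotone (le_max_left _ _) (hbM r hr)
    have hc' : ∀ r < 2 * (j + 1) + 2, c r ∈ A (max M I') := fun r hr =>
      hA.monotone (le_max_right _ _) (hI' r hr)
    exact (hconf j _).crossRatioDefect_eq_zero (by positivity) (Nat.succ_pos j)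
      (hb' _ (by omega)) (hb' _ (by omega)) (hb' _ (by omega)) (hb' _ (by omega))
      (hb' _ (by omega)) (hb' _ (by omega)) (fun m hm => hc' _ (by omega))
      (fun m hm => hc' _ (by omega)) (hW _)

end IsCompatibleSequence

/-! ### Absence of weak subdivisions -/

theorem mainTheorem2 (k : ℕ) (hk : 3 ≤ k) (A : ℕ → Set RInf) (hA : IsCompatibleSequence A) :
    (¬ ∃ Q : Set (Set (Grassmannian k RInf)),
      IsWeakSubdivision Q (orientedMatroidStratification k A)) ∧
    (¬ ∃ Q : Set (Set (Grassmannian k RInf)),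
      IsWeakSubdivision Q (matroidStratification k A)) := by
  obtain ⟨x, z, C, y, hx, hC, hyx, hsep, hy, hyC⟩ := hA.exists_separating hk
  constructor
  · exact not_isWeakSubdivision_of_separating hx (fun j => ⟨y j 0, rfl⟩)
      (fun j W hW => hyC j W fun i => matroidOf_eq_of_orientedMatroidOf_eq (hW i)) hC
      (fun j m => hy j m) hyx hsep
  · exact not_isWeakSubdivision_of_separating hx (fun j => ⟨y j 0, rfl⟩)
      (fun j W hW => hyC j W hW) hC
      (fun j m i => matroidOf_eq_of_orientedMatroidOf_eq (hy j m i)) hyx hsep
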